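/- Let $\Omega=\{0,1\}^{\mathbb N}$ be the space of infinite binary sequences with the uniform Bernoulli distribution $P$, and let $\Sigma$ be the space of all finite and infinite binary sequences. A mapping $T\colon\Omega\to\Sigma$ is called computable if there is an oracle machine that, given read access to the bits of $\omega\in\Omega$, writes sequentially on its output tape exactly the bits of $T(\omega)$. A sequence $\omega\in\Omega$ is Martin-Löf random if there is no uniformly computably enumerable sequence of open sets $U_0,U_1,\dots\subseteq\Omega$ with $P(U_k)\le 2^{-k}$ for all $k$ and $\omega\in\bigcap_k U_k$. Theorem (Gács–Kučera, in Levin's form). There exist a computable mapping $T\colon\Omega\to\Sigma$ and a constant $c$ such that: (a) $T$ uses only the first $2n+c$ input bits to produce $n$ output bits: $T$ is computed by an oracle machine that, on every input and for every $n$, reads only bits among the first $2n+c$ bits of the input as long as it has written fewer than $n$ output bits; in particular, for all $n$ and all $\omega,\omega'\in\Omega$ with the same first $2n+c$ bits, the first $n$ bits of $T(\omega)$ and $T(\omega')$ coincide (including which of these bits exist); (b) for every infinite binary sequence $\alpha$ there exists a Martin-Löf random sequence $\omega$ such that $T(\omega)=\alpha$; moreover, $\alpha$ is Turing-reducible to $\omega$.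 Consequently, every infinite binary sequence is Turing-reducible to some Martin-Löf random sequence. -/

import Mathlib

open MeasureTheory
open scoped ENNReal

/-- The space `Ω` of infinite binary sequences. -/
abbrev BinSeq : Type := ℕ → Bool

/-- The space `Σ` of finite and infinite binary sequences: an element `s` has entries
`s.get? 0, s.get? 1, …`, which are `none` from the end of `s` on if `s` is finite. -/
abbrev FinInfSeq : Type := Stream'.Seq Bool

/-- An infinite sequence, viewed as an element of `Σ`. -/
def BinSeq.toFinInf (α : BinSeq) : FinInfSeq := Stream'.Seq.ofStream α

/-- The cone of all infinite sequences that have the finite string `x` as a prefix. -/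
def cone (x : List Bool) : Set BinSeq :=
  {ω | ∀ (i : ℕ) (h : i < x.length), ω i = x[i]}

/-- The uniform Bernoulli distribution on `Ω`: the bits are independent fair coin tosses. -/
noncomputable def uniformBernoulli : Measure BinSeq :=
  Measure.infinitePi fun _ : ℕ => (PMF.uniformOfFintype Bool).toMeasure

/-- The open subset of `Ω` generated by the strings that `W` lists at level `k`. -/
def levelSet (W : Set (ℕ × List Bool)) (k : ℕ) : Set BinSeq :=
  {ω | ∃ x : List Bool, (k, x) ∈ W ∧ ω ∈ cone x}

/-- A Martin-Löf test for the uniform distribution: a uniformly computably enumerable sequence of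
open sets, the `k`-th of which has measure at most `2 ^ (-k)`. -/
def IsMartinLofTest (W : Set (ℕ × List Bool)) : Prop :=
  REPred (fun p : ℕ × List Bool => p ∈ W) ∧
    ∀ k : ℕ, uniformBernoulli (levelSet W k) ≤ (2⁻¹ : ℝ≥0∞) ^ k

/-- `ω` is Martin-Löf random with respect to the uniform distribution: no Martin-Löf test
contains `ω` in all of its levels. -/
def IsMartinLofRandom (ω : BinSeq) : Prop :=
  ∀ W : Set (ℕ × List Bool), IsMartinLofTest W → ∃ k : ℕ, ω ∉ levelSet W k

/-- An oracle machine with read access to an infinite bit sequence and a one-way, write-only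
output tape. The internal configurations (state, work tapes, head positions) are coded by natural
numbers, the initial one by `0`. In configuration `q` the machine may read the input bit at the
position `query q`, may append the bit `write q` to the output, and passes to the configuration
`next q a`, where `a` is the bit that was read, if any. Each of these is a computable function of
finite data, so the input is accessible only bit by bit, through the queries. A machine that halts
is one that from some moment on neither reads nor writes. -/
structure OracleMachine where
  query : ℕ → Option ℕ
  write : ℕ → Option Bool
  next : ℕ → Option Bool → ℕ
  computable_query : Computable query
  computable_write : Computable write
  computable_next : Computable₂ next

namespace OracleMachine

/-- The configuration and the content of the output tape after `t` steps on input `ω`. -/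
def run (M : OracleMachine) (ω : BinSeq) : ℕ → ℕ × List Bool
  | 0 => (0, [])
  | t + 1 =>
    (M.next (M.run ω t).1 ((M.query (M.run ω t).1).map ω),
      (M.run ω t).2 ++ (M.write (M.run ω t).1).toList)

/-- `M` computes the mapping `T : Ω → Σ`: for every input `ω`, the sequence `T ω` is the (finite or
infinite) sequence of all bits that `M` ever writes on input `ω`. -/
def Computes (M : OracleMachine) (T : BinSeq → FinInfSeq) : Prop :=
  ∀ (ω : BinSeq) (n : ℕ) (b : Bool),
    (T ω).get? n = some b ↔ ∃ t : ℕ, (M.run ω t).2[n]? = some b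

/-- On every input, every bit read while the output has length `k` is among the first `u (k + 1)`
bits of the input. For monotone `u` this says that `M` reads only the first `u n` input bits to
produce `n` output bits. -/
def UseBoundedBy (M : OracleMachine) (u : ℕ → ℕ) : Prop :=
  ∀ (ω : BinSeq) (t i : ℕ),
    M.query (M.run ω t).1 = some i → i < u ((M.run ω t).2.length + 1)

end OracleMachine

/-- The first `n` bits of `T ω` (including whether they are there) depend only on the first `u n`
bits of `ω`. -/
def OutputDependsOnFirst (T : BinSeq → FinInfSeq) (u : ℕ → ℕ) : Prop :=
  ∀ (n : ℕ) (ω ω' : BinSeq), (∀ i < u n, ω i = ω' i) →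
    ∀ m < n, (T ω).get? m = (T ω').get? m

/-- A binary sequence as a (total) number-theoretic function. -/
def BinSeq.toPFun (ω : BinSeq) : ℕ →. ℕ := fun n => Part.some (ω n).toNat

/-!
The sequences that are not random lie in an effectively open set of measure at most `1 / 2`; call
the part of it enumerated so far rejected. Build in stages a monotone map on strings that sends
strings of length `2 n` to strings of length `n`, and call a string `x` poor if the part of its
preimage that is not rejected has measure less than `2 ^ (-(2 |x| + 1))`. Whenever `x` is poor, try
to map one more string to it: a two-bit extension, unused and not rejected, of a string mapped to
the parent of `x`. Enlarging only poor preimages keeps them all so small that two children, one of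
them poor, never exhaust the preimage of a parent that is not poor, so such an extension exists.
There are finitely many candidates for each `x`, hence every `x` is eventually never poor, and
compactness gives for every `α` a sequence that is never rejected and is mapped to `α`.
-/

open Encodable Filter
open PiNat (res)

/-! ### Initial segments and the open sets they generate -/

section Restriction

variable {α : Type*}

theorem res_suffix_res (x : ℕ → α) {m n : ℕ} (h : m ≤ n) : res x m <:+ res x n := by
  induction n, h using Nat.le_induction with
  | base => exact List.suffix_rfl
  | succ n _ ih => exact ih.trans (List.suffix_cons _ _)

theorem suffix_res_iff (x : ℕ → α) {y : List α} {n : ℕ} (h : y.length ≤ n) :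
    y <:+ res x n ↔ res x y.length = y := by
  refine ⟨fun hy => ?_, fun hy => hy ▸ res_suffix_res x h⟩
  exact (List.suffix_of_suffix_length_le (res_suffix_res x h) hy (by simp)).eq_of_length (by simp)

theorem reverse_res (x : ℕ → α) (n : ℕ) : (res x n).reverse = (List.range n).map x := by
  induction n with
  | zero => rfl
  | succ n ih => simp [List.range_succ, ih]

theorem exists_res_length_eq [Inhabited α] (z : List α) : ∃ x : ℕ → α, res x z.length = z := by
  refine ⟨fun i => z.reverse.getD i default, List.reverse_injective ?_⟩
  rw [reverse_res]
  exact List.ext_getElem (by simp) fun i _ hi => by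
    rw [List.getElem_map, List.getElem_range, List.getD_eq_getElem]

theorem isLocallyConstant_res [TopologicalSpace α] [DiscreteTopology α] (n : ℕ) :
    IsLocallyConstant fun x : ℕ → α => res x n :=
  (IsLocallyConstant.iff_exists_open _).2 fun x =>
    ⟨PiNat.cylinder x n, PiNat.isOpen_cylinder _ x n, PiNat.self_mem_cylinder x n,
      fun y hy => by rwa [PiNat.cylinder_eq_res] at hy⟩

end Restriction

theorem mem_cone_iff_res (ω : BinSeq) (x : List Bool) :
    ω ∈ cone x ↔ res ω x.length = x.reverse := by
  rw [← List.reverse_eq_iff, reverse_res, List.ext_getElem_iff]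
  simp [cone]

/-- The open set of all sequences that begin with a string in `L`. The strings are written
backwards, like the initial segments `PiNat.res ω n`. -/
def openOf (L : List (List Bool)) : Set BinSeq :=
  {ω | ∃ y ∈ L, res ω y.length = y}

theorem mem_openOf_singleton {ω : BinSeq} {y : List Bool} :
    ω ∈ openOf [y] ↔ res ω y.length = y := by
  simp [openOf]

theorem openOf_mono {L L' : List (List Bool)} (h : L ⊆ L') : openOf L ⊆ openOf L' :=
  fun _ ⟨y, hy, hω⟩ => ⟨y, h hy, hω⟩

theorem isOpen_openOf (L : List (List Bool)) : IsOpen (openOf L) := by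
  have h : openOf L = ⋃ y ∈ L, {ω | res ω y.length = y} := by ext; simp [openOf]
  rw [h]
  exact isOpen_biUnion fun y _ => (isLocallyConstant_res y.length).isOpen_fiber y

/-- The (backwards) string `z` begins with a string in `L`. -/
def ExtendsSome (L : List (List Bool)) (z : List Bool) : Prop := ∃ y ∈ L, y <:+ z

-- The total length of the strings in `L` serves as a computable bound on their lengths.
theorem extendsSome_res_iff {L : List (List Bool)} {n : ℕ} (h : L.flatten.length ≤ n)
    (ω : BinSeq) : ExtendsSome L (res ω n) ↔ ω ∈ openOf L :=
  exists_congr fun _ => and_congr_right fun hy =>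
    suffix_res_iff ω ((List.sublist_flatten_of_mem hy).length_le.trans h)

/-- All binary strings of length `n`. -/
def boolStrings : ℕ → List (List Bool)
  | 0 => [[]]
  | n + 1 => (boolStrings n).flatMap fun z => [false :: z, true :: z]

@[simp] theorem mem_boolStrings {n : ℕ} {z : List Bool} : z ∈ boolStrings n ↔ z.length = n := by
  induction n generalizing z with
  | zero => simp [boolStrings]
  | succ n ih =>
    rcases z with _ | ⟨_ | _, z⟩ <;> simp [boolStrings, ih]

theorem nodup_boolStrings (n : ℕ) : (boolStrings n).Nodup := by
  induction n with
  | zero => simp [boolStrings]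
  | succ n ih =>
    rw [boolStrings, List.nodup_flatMap]
    refine ⟨fun _ _ => by simp, ih.imp fun {y z} hyz => ?_⟩
    simp [Function.onFun, Ne.symm hyz]

/-- An enumeration of all binary strings, with repetitions. -/
def decodeString (n : ℕ) : List Bool := (decode n).getD []

@[simp] theorem decodeString_encode (x : List Bool) : decodeString (encode x) = x := by
  simp [decodeString]

section Measure

instance : IsProbabilityMeasure uniformBernoulli := by
  unfold uniformBernoulli; infer_instance

theorem uniformBernoulli_openOf_singleton (z : List Bool) :
    uniformBernoulli.real (openOf [z]) = 2⁻¹ ^ z.length := by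
  obtain ⟨α, hα⟩ := exists_res_length_eq z
  have hcylinder : openOf [z] = Set.pi (Finset.range z.length) fun i => {α i} := by
    rw [← PiNat.cylinder_eq_pi, PiNat.cylinder_eq_res, hα]
    exact Set.ext fun _ => mem_openOf_singleton
  rw [hcylinder, Measure.real, uniformBernoulli, Measure.infinitePi_pi _ (by simp)]
  simp

theorem uniformBernoulli_setOf_res (n : ℕ) (Q : List Bool → Prop) [DecidablePred Q] :
    uniformBernoulli.real {ω | Q (res ω n)} =
      ((boolStrings n).filter fun z => Q z).length / 2 ^ n := by
  have hunion : {ω | Q (res ω n)} =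
      ⋃ z ∈ ((boolStrings n).filter fun z => Q z).toFinset, {ω | res ω n = z} := by
    ext ω; simp
  have hpart : ∀ z ∈ ((boolStrings n).filter fun z => Q z).toFinset,
      uniformBernoulli.real {ω | res ω n = z} = 2⁻¹ ^ n := by
    intro z hz
    obtain ⟨rfl, -⟩ : z.length = n ∧ Q z := by simpa using hz
    rw [← uniformBernoulli_openOf_singleton]
    exact congrArg _ (Set.ext fun _ => mem_openOf_singleton.symm)
  rw [hunion, measureReal_biUnion_finset
      (fun y _ z _ hyz => Set.disjoint_left.2 fun ω hy hz => hyz (hy.symm.trans hz))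
      (fun z _ => ((isLocallyConstant_res n).isOpen_fiber z).measurableSet),
    Finset.sum_congr rfl hpart, Finset.sum_const,
    List.toFinset_card_of_nodup ((nodup_boolStrings n).filter _), nsmul_eq_mul, inv_pow,
    div_eq_mul_inv]

end Measure

section Primrec

theorem primrec_boolStrings : Primrec boolStrings := by
  refine (Primrec.nat_rec₁ [[]] (Primrec.list_flatMap Primrec.snd
    (g := fun _ z => [false :: z, true :: z]) ?_).to₂).of_eq fun n => ?_
  · exact Primrec.list_cons.comp (Primrec.list_cons.comp (Primrec.const false) Primrec.snd)
      (Primrec.list_cons.comp (Primrec.list_cons.comp (Primrec.const true) Primrec.snd)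
        (Primrec.const []))
  · induction n with
    | zero => rfl
    | succ n ih => simp only [boolStrings, ← ih]

theorem primrec_decodeString : Primrec decodeString :=
  Primrec.option_getD.comp Primrec.decode (Primrec.const [])

theorem primrec_two_pow : Primrec fun n : ℕ => 2 ^ n := by
  refine (Primrec.nat_rec₁ 1 (Primrec.nat_mul.comp Primrec.snd (Primrec.const 2)).to₂).of_eq
    fun n => ?_
  induction n with
  | zero => rfl
  | succ n ih => rw [pow_succ, ← ih]

theorem primrecRel_suffix {α : Type*} [Primcodable α] :
    PrimrecRel fun y z : List α => y <:+ z := by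
  refine PrimrecRel.of_eq (r := fun y z : List α => y = z.drop (z.length - y.length)) ?_
    fun y z => List.suffix_iff_eq_drop.symm
  exact Primrec.eq.comp Primrec.fst (Primrec.list_drop.comp (Primrec.nat_sub.comp
    (Primrec.list_length.comp Primrec.snd) (Primrec.list_length.comp Primrec.fst)) Primrec.snd)

theorem primrecRel_extendsSome : PrimrecRel ExtendsSome :=
  primrecRel_suffix.exists_mem_list

theorem primrec_length_flatten_append :
    Primrec₂ fun L L' : List (List Bool) => (L ++ L').flatten.length :=
  Primrec.list_length.comp (Primrec.list_flatten.comp Primrec.list_append)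

theorem primrecRel_openOf_subset :
    PrimrecRel fun L L' : List (List Bool) => openOf L ⊆ openOf L' := by
  have hrel : PrimrecRel fun (z : List Bool) (p : List (List Bool) × List (List Bool)) =>
      ¬ ExtendsSome p.1 z ∨ ExtendsSome p.2 z :=
    (primrecRel_extendsSome.comp (Primrec.fst.comp Primrec.snd) Primrec.fst).not.or
      (primrecRel_extendsSome.comp (Primrec.snd.comp Primrec.snd) Primrec.fst)
  refine (hrel.forall_mem_list.comp (primrec_boolStrings.comp primrec_length_flatten_append)
    Primrec.id).of_eq fun ⟨L, L'⟩ => ?_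
  simp only [mem_boolStrings, ← imp_iff_not_or, id_eq]
  constructor
  · intro h ω
    rw [← extendsSome_res_iff (n := (L ++ L').flatten.length) (by simp),
      ← extendsSome_res_iff (n := (L ++ L').flatten.length) (by simp)]
    exact h _ (by simp)
  · intro h z hz
    obtain ⟨ω, hω⟩ := exists_res_length_eq z
    rw [← hω, hz, extendsSome_res_iff (by simp), extendsSome_res_iff (by simp)]
    exact @h ω

theorem primrecPred_uniformBernoulli_sdiff_lt :
    PrimrecPred fun p : (List (List Bool) × List (List Bool)) × ℕ =>
      uniformBernoulli.real (openOf p.1.1 \ openOf p.1.2) < 2⁻¹ ^ p.2 := by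
  classical
  let depth (p : List (List Bool) × List (List Bool)) : ℕ := (p.1 ++ p.2).flatten.length
  have hdepth : Primrec depth := primrec_length_flatten_append
  have hrel : PrimrecRel fun (z : List Bool) (p : List (List Bool) × List (List Bool)) =>
      ExtendsSome p.1 z ∧ ¬ ExtendsSome p.2 z :=
    (primrecRel_extendsSome.comp (Primrec.fst.comp Primrec.snd) Primrec.fst).and
      (primrecRel_extendsSome.comp (Primrec.snd.comp Primrec.snd) Primrec.fst).not
  have hcount := Primrec.list_length.comp
    (hrel.listFilter.comp (primrec_boolStrings.comp hdepth) Primrec.id)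
  refine (Primrec.nat_lt.comp (Primrec.nat_mul.comp (hcount.comp Primrec.fst)
    (primrec_two_pow.comp Primrec.snd)) (primrec_two_pow.comp (hdepth.comp Primrec.fst))).of_eq
    fun ⟨⟨L, L'⟩, k⟩ => ?_
  have hset : openOf L \ openOf L' = {ω | ExtendsSome L (res ω (depth (L, L'))) ∧
      ¬ ExtendsSome L' (res ω (depth (L, L')))} := by
    ext ω
    simp only [Set.mem_sdiff, Set.mem_ofPred_eq]
    rw [extendsSome_res_iff (by simp [depth]), extendsSome_res_iff (by simp [depth])]
  rw [hset, uniformBernoulli_setOf_res _ fun z => ExtendsSome L z ∧ ¬ ExtendsSome L' z,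
    div_lt_iff₀ (by positivity), inv_pow, inv_mul_eq_div, lt_div_iff₀ (by positivity)]
  exact_mod_cast Iff.rfl

end Primrec

/-! ### A universal Martin-Löf test -/

section UniversalTest

open Nat.Partrec (Code)

/-- The strings `x` (written backwards) such that the `e`-th program is seen within `s` steps to
accept `(e + 3, x)`. -/
def acceptedStrings (e s : ℕ) : List (List Bool) :=
  (((List.range s).map decodeString).filter fun x =>
    (Code.evaln s (Denumerable.ofNat Code e) (encode (e + 3, x))).isSome).map List.reverse

theorem mem_acceptedStrings {e s : ℕ} {y : List Bool} :
    y ∈ acceptedStrings e s ↔ (∃ n < s, decodeString n = y.reverse) ∧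
      (Code.evaln s (Denumerable.ofNat Code e) (encode (e + 3, y.reverse))).isSome := by
  rw [← List.reverse_reverse y]
  simp only [acceptedStrings, List.mem_map_of_injective List.reverse_injective]
  simp

theorem acceptedStrings_mono (e : ℕ) {s t : ℕ} (h : s ≤ t) :
    acceptedStrings e s ⊆ acceptedStrings e t := by
  intro y hy
  rw [mem_acceptedStrings] at hy ⊢
  obtain ⟨⟨n, hn, hny⟩, hacc⟩ := hy
  obtain ⟨v, hv⟩ := Option.isSome_iff_exists.1 hacc
  exact ⟨⟨n, hn.trans_le h, hny⟩, Option.isSome_iff_exists.2 ⟨v, Code.evaln_mono h hv⟩⟩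

theorem exists_levelSet_eq_iUnion_openOf {W : Set (ℕ × List Bool)} (hW : REPred (· ∈ W)) :
    ∃ e, levelSet W (e + 3) = ⋃ s, openOf (acceptedStrings e s) := by
  obtain ⟨c, hc⟩ := Code.exists_code.1 hW
  have hmem (p : ℕ × List Bool) :
      p ∈ W ↔ ∃ k, (Code.evaln k c (encode p)).isSome := by
    simp_rw [Option.isSome_iff_exists, ← Option.mem_def]
    rw [exists_comm]
    simp_rw [← Code.evaln_complete, hc, encodek]
    simp
  refine ⟨encode c, Set.ext fun ω => ?_⟩
  simp only [levelSet, openOf, Set.mem_ofPred_eq, Set.mem_iUnion, mem_acceptedStrings,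
    Denumerable.ofNat_encode]
  constructor
  · rintro ⟨x, hx, hω⟩
    obtain ⟨k, hk⟩ := (hmem _).1 hx
    obtain ⟨v, hv⟩ := Option.isSome_iff_exists.1 hk
    refine ⟨max k (encode x + 1), x.reverse, ⟨⟨encode x, by omega, by simp⟩, ?_⟩, ?_⟩
    · rw [List.reverse_reverse]
      exact Option.isSome_iff_exists.2 ⟨v, Code.evaln_mono (le_max_left _ _) hv⟩
    · rw [List.length_reverse]
      exact (mem_cone_iff_res _ _).1 hω
  · rintro ⟨s, y, ⟨-, hacc⟩, hω⟩
    exact ⟨y.reverse, (hmem _).2 ⟨s, hacc⟩, (mem_cone_iff_res _ _).2 (by simpa using hω)⟩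

/-- The strings accepted by the `e`-th program within `s` steps do not yet cover too large a set.
The inequality is strict, hence the level `e + 3` in `acceptedStrings`. -/
def IsSmall (e s : ℕ) : Prop :=
  uniformBernoulli.real (openOf (acceptedStrings e s)) < 2⁻¹ ^ (e + 2)

noncomputable instance (e : ℕ) : DecidablePred (IsSmall e) := Classical.decPred _

theorem isSmall_zero (e : ℕ) : IsSmall e 0 := by
  simp [IsSmall, openOf, acceptedStrings]

/-- The stage `s` approximation of the universal Martin-Löf test: the strings accepted by the first
`s` programs, each of which is stopped before it covers too large a set. -/
noncomputable def universalStrings (s : ℕ) : List (List Bool) :=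
  (List.range s).flatMap fun e => acceptedStrings e (Nat.findGreatest (IsSmall e) s)

theorem universalStrings_mono {s t : ℕ} (h : s ≤ t) :
    universalStrings s ⊆ universalStrings t := by
  intro y hy
  simp only [universalStrings, List.mem_flatMap, List.mem_range] at hy ⊢
  obtain ⟨e, he, hy⟩ := hy
  exact ⟨e, he.trans_le h, acceptedStrings_mono e (Nat.findGreatest_mono_right _ h) hy⟩

theorem uniformBernoulli_openOf_universalStrings_le (s : ℕ) :
    uniformBernoulli.real (openOf (universalStrings s)) ≤ 2⁻¹ := by
  let L (e : ℕ) : List (List Bool) := acceptedStrings e (Nat.findGreatest (IsSmall e) s)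
  have hunion : openOf (universalStrings s) ⊆ ⋃ e ∈ Finset.range s, openOf (L e) := by
    rintro ω ⟨y, hy, hω⟩
    obtain ⟨e, he, hy⟩ := List.mem_flatMap.1 hy
    exact Set.mem_biUnion (by simpa using he) ⟨y, hy, hω⟩
  have hsmall (e : ℕ) : uniformBernoulli.real (openOf (L e)) ≤ 2⁻¹ ^ (e + 2) :=
    (Nat.findGreatest_spec (Nat.zero_le s) (isSmall_zero e)).le
  calc uniformBernoulli.real (openOf (universalStrings s))
      ≤ ∑ e ∈ Finset.range s, uniformBernoulli.real (openOf (L e)) :=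
        (measureReal_mono hunion (measure_ne_top _ _)).trans (measureReal_biUnion_finset_le _ _)
    _ ≤ ∑ e ∈ Finset.range s, 2⁻¹ ^ (e + 2) := Finset.sum_le_sum fun e _ => hsmall e
    _ = (∑ e ∈ Finset.range s, (1 / 2 : ℝ) ^ e) * 2⁻¹ ^ 2 := by
        simp_rw [pow_add, Finset.sum_mul, one_div]
    _ ≤ 2⁻¹ := by linarith [sum_geometric_two_le s]

theorem isMartinLofRandom_of_forall_notMem {ω : BinSeq}
    (hω : ∀ s, ω ∉ openOf (universalStrings s)) : IsMartinLofRandom ω := by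
  rintro W ⟨hW, hμ⟩
  by_contra! hall
  obtain ⟨e, he⟩ := exists_levelSet_eq_iUnion_openOf hW
  obtain ⟨s, hs⟩ := Set.mem_iUnion.1 (he ▸ hall (e + 3))
  have hsmall : IsSmall e s := by
    have hle : uniformBernoulli (openOf (acceptedStrings e s)) ≤ 2⁻¹ ^ (e + 3) :=
      (measure_mono (he ▸ Set.subset_iUnion (fun s => openOf (acceptedStrings e s)) s)).trans
        (hμ (e + 3))
    calc uniformBernoulli.real (openOf (acceptedStrings e s))
        ≤ 2⁻¹ ^ (e + 3) := by simpa [Measure.real] using ENNReal.toReal_mono (by simp) hle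
      _ < 2⁻¹ ^ (e + 2) := pow_lt_pow_right_of_lt_one₀ (by norm_num) (by norm_num) (by omega)
  refine hω (max (e + 1) s) (openOf_mono (fun y hy => ?_) hs)
  refine List.mem_flatMap.2 ⟨e, by simp, acceptedStrings_mono e ?_ hy⟩
  exact Nat.le_findGreatest (le_max_right _ _) hsmall

theorem primrec_acceptedStrings : Primrec₂ acceptedStrings := by
  have hcode : Primrec fun q : List Bool × ℕ × ℕ => encode (q.2.1 + 3, q.1) :=
    Primrec.encode.comp (Primrec.pair
      (Primrec.nat_add.comp (Primrec.fst.comp Primrec.snd) (Primrec.const 3)) Primrec.fst)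
  have heval := Code.primrec_evaln.comp (Primrec.pair (Primrec.pair
    (Primrec.snd.comp Primrec.snd)
    ((Primrec.ofNat Code).comp (Primrec.fst.comp Primrec.snd))) hcode)
  have haccept : PrimrecRel fun (x : List Bool) (p : ℕ × ℕ) =>
      (Code.evaln p.2 (Denumerable.ofNat Code p.1) (encode (p.1 + 3, x))).isSome = true :=
    Primrec.eq.comp (Primrec.option_isSome.comp heval) (Primrec.const true)
  have hstrings : Primrec fun p : ℕ × ℕ => (List.range p.2).map decodeString :=
    Primrec.list_map (Primrec.list_range.comp Primrec.snd)
      (primrec_decodeString.comp Primrec.snd).to₂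
  exact (Primrec.list_map (haccept.listFilter.comp hstrings Primrec.id)
    (Primrec.list_reverse.comp Primrec.snd).to₂).of_eq fun p =>
    congrArg _ (List.filter_congr fun _ _ => Bool.decide_eq_true)

theorem primrecRel_isSmall : PrimrecRel IsSmall := by
  refine (primrecPred_uniformBernoulli_sdiff_lt.comp (Primrec.pair (Primrec.pair
    primrec_acceptedStrings (Primrec.const []))
    (Primrec.nat_add.comp Primrec.fst (Primrec.const 2)))).of_eq fun p => ?_
  simp [IsSmall, openOf]

theorem primrec_universalStrings : Primrec universalStrings := by
  have hstage : Primrec fun p : ℕ × ℕ => Nat.findGreatest (IsSmall p.2) p.1 :=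
    Primrec.nat_findGreatest Primrec.fst
      (primrecRel_isSmall.comp (Primrec.snd.comp Primrec.fst) Primrec.snd)
  exact Primrec.list_flatMap Primrec.list_range
    (primrec_acceptedStrings.comp Primrec.snd hstage).to₂

end UniversalTest

/-! ### Tables of monotone maps -/

theorem openOf_append (L L' : List (List Bool)) : openOf (L ++ L') = openOf L ∪ openOf L' := by
  ext ω
  simp only [openOf, List.mem_append, or_and_right, exists_or]
  rfl

section Table

/-- A finite part of a monotone map on strings: the pairs `(y, x)` such that every sequence that
begins with `y` is mapped to one that begins with `x`, both strings being written backwards. -/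
abbrev Table : Type := List (List Bool × List Bool)

namespace Table

variable (A : Table) (V : List (List Bool)) (x y : List Bool)

/-- The input strings that are mapped to `x`. -/
def preimage : List (List Bool) := (A.filter fun p => p.2 = x).map Prod.fst

/-- The sequences that are mapped to a sequence beginning with `x` and are not rejected by `V`. -/
def live : Set BinSeq := openOf (A.preimage x) \ openOf V

/-- The live preimage of `x` has measure less than `2 ^ (-(2 * |x| + 1))`. -/
def IsPoor : Prop := uniformBernoulli.real (A.live V x) < 2⁻¹ ^ (2 * x.length + 1)

/-- The string `y` may be added to the preimage of `x`: without its last two bits it is mapped to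
the parent of `x`, it has no output yet, and its cone is not completely rejected by `V`. -/
def IsAssignable : Prop :=
  (y.drop 2, x.tail) ∈ A ∧ y ∉ A.map Prod.fst ∧ ¬ openOf [y] ⊆ openOf V

open Classical in
/-- The first input string, if any, that may be added to the preimage of `x`. -/
noncomputable def firstAssignable : Option (List Bool) :=
  ((boolStrings (2 * x.length)).filter fun y => A.IsAssignable V x y).head?

open Classical in
/-- The preimage of `x` gets a new string if it is poor. -/
noncomputable def extend : Table :=
  if A.IsPoor V x then A ++ ((A.firstAssignable V x).map fun y => (y, x)).toList else A

variable {A V x y}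

@[simp] theorem mem_preimage : y ∈ A.preimage x ↔ (y, x) ∈ A := by
  simp [preimage]

theorem preimage_append (A B : Table) (x : List Bool) :
    preimage (A ++ B) x = A.preimage x ++ B.preimage x := by
  simp [preimage]

theorem preimage_prefix {B : Table} (h : A <+: B) (x : List Bool) :
    A.preimage x <+: B.preimage x :=
  (h.filter _).map _

theorem live_anti (A : Table) {V V' : List (List Bool)} (h : V ⊆ V') (x : List Bool) :
    A.live V' x ⊆ A.live V x :=
  Set.sdiff_subset_sdiff_right (openOf_mono h)

theorem length_and_isAssignable_of_mem_firstAssignable (h : y ∈ A.firstAssignable V x) :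
    y.length = 2 * x.length ∧ A.IsAssignable V x y := by
  simpa using List.mem_of_mem_head? h

theorem isSome_firstAssignable (hlen : y.length = 2 * x.length) (hy : A.IsAssignable V x y) :
    (A.firstAssignable V x).isSome := by
  rw [firstAssignable, List.isSome_head?]
  exact List.ne_nil_of_mem (a := y) (by simp [hlen, hy])

theorem prefix_extend (A : Table) (V : List (List Bool)) (x : List Bool) :
    A <+: A.extend V x := by
  unfold extend
  split_ifs
  exacts [List.prefix_append _ _, List.prefix_rfl]

theorem extend_cases (A : Table) (V : List (List Bool)) (x : List Bool) :
    A.extend V x = A ∨ ∃ y, A.extend V x = A ++ [(y, x)] ∧ A.IsPoor V x ∧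
      y.length = 2 * x.length ∧ A.IsAssignable V x y := by
  unfold extend
  split_ifs with hpoor
  · cases h : A.firstAssignable V x with
    | none => exact Or.inl (by simp)
    | some y =>
      exact Or.inr ⟨y, by simp, hpoor, length_and_isAssignable_of_mem_firstAssignable h⟩
  · exact Or.inl rfl

theorem length_preimage_lt_extend (hpoor : A.IsPoor V x) (hlen : y.length = 2 * x.length)
    (hy : A.IsAssignable V x y) :
    (A.preimage x).length < ((A.extend V x).preimage x).length := by
  obtain ⟨y', hy'⟩ := Option.isSome_iff_exists.1 (isSome_firstAssignable hlen hy)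
  simp [extend, hpoor, hy', preimage]

-- The preimage of `x` is enlarged only if it is poor, hence never becomes too rich.
theorem measureReal_live_extend_le (A : Table) (V : List (List Bool)) (x x' : List Bool) :
    uniformBernoulli.real ((A.extend V x').live V x) ≤
      max (uniformBernoulli.real (A.live V x))
        (2⁻¹ ^ (2 * x.length + 1) + 2⁻¹ ^ (2 * x.length)) := by
  rcases A.extend_cases V x' with h | ⟨y, h, hpoor, hlen, -⟩
  · rw [h]
    exact le_max_left _ _
  rw [h]
  by_cases hx : x' = x
  · subst hx
    have hsub : live (A ++ [(y, x')]) V x' ⊆ A.live V x' ∪ openOf [y] := by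
      rw [live, preimage_append, openOf_append, Set.union_sdiff_distrib]
      exact Set.union_subset_union_right _ (Set.sdiff_subset.trans (by simp [preimage]))
    calc uniformBernoulli.real (live (A ++ [(y, x')]) V x')
        ≤ uniformBernoulli.real (A.live V x') + uniformBernoulli.real (openOf [y]) :=
          (measureReal_mono hsub).trans (measureReal_union_le _ _)
      _ ≤ 2⁻¹ ^ (2 * x'.length + 1) + 2⁻¹ ^ (2 * x'.length) := by
          rw [uniformBernoulli_openOf_singleton, hlen]
          exact add_le_add_left hpoor.le _
      _ ≤ _ := le_max_right _ _
  · have heq : live (A ++ [(y, x')]) V x = A.live V x := by simp [live, preimage, hx]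
    rw [heq]
    exact le_max_left _ _

end Table

open Table

/-- `A` is a finite part of a monotone map that produces one output bit for two input bits. -/
structure IsTable (A : Table) : Prop where
  root : ([], []) ∈ A
  nodup_keys : (A.map Prod.fst).Nodup
  length_eq {y x : List Bool} : (y, x) ∈ A → y.length = 2 * x.length
  parent {y x : List Bool} {b : Bool} : (y, b :: x) ∈ A → (y.drop 2, x) ∈ A

theorem isTable_singleton : IsTable [([], [])] := by
  constructor <;> simp

namespace IsTable

variable {A : Table} {V : List (List Bool)} {x x' y : List Bool} {ω : BinSeq}

theorem extend (hA : IsTable A) (V : List (List Bool)) (x : List Bool) :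
    IsTable (A.extend V x) := by
  rcases A.extend_cases V x with h | ⟨y, h, -, hlen, hdrop, hkey, -⟩ <;> rw [h]
  · exact hA
  · refine ⟨by simp [hA.root], ?_, fun {y' x'} hy' => ?_, fun {y' x' b} hy' => ?_⟩
    · rw [List.map_append, List.map_singleton, ← List.concat_eq_append]
      exact hA.nodup_keys.concat hkey
    · rcases List.mem_append.1 hy' with hy' | hy'
      · exact hA.length_eq hy'
      · obtain ⟨rfl, rfl⟩ : y' = y ∧ x' = x := by simpa using hy'
        exact hlen
    · refine List.mem_append_left _ ?_
      rcases List.mem_append.1 hy' with hy' | hy'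
      · exact hA.parent hy'
      · obtain ⟨rfl, rfl⟩ : y' = y ∧ b :: x' = x := by simpa using hy'
        exact hdrop

theorem eq_of_mem (hA : IsTable A) (h : (y, x) ∈ A) (h' : (y, x') ∈ A) : x = x' :=
  congrArg Prod.snd (List.inj_on_of_nodup_map hA.nodup_keys h h' rfl)

theorem lookup_eq_some_iff (hA : IsTable A) : A.lookup y = some x ↔ (y, x) ∈ A := by
  have mem_of_lookup {x : List Bool} (h : A.lookup y = some x) : (y, x) ∈ A := by
    obtain ⟨l₁, l₂, rfl, -⟩ := List.lookup_eq_some_iff.1 h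
    simp
  refine ⟨mem_of_lookup, fun h => ?_⟩
  obtain ⟨x', hx'⟩ : ∃ x', A.lookup y = some x' := by
    rw [← Option.isSome_iff_exists, List.lookup_isSome_iff]
    exact ⟨_, h, beq_self_eq_true y⟩
  rw [hx', hA.eq_of_mem h (mem_of_lookup hx')]

theorem mem_openOf_preimage (hA : IsTable A) :
    ω ∈ openOf (A.preimage x) ↔ (res ω (2 * x.length), x) ∈ A := by
  constructor
  · rintro ⟨y, hy, hω⟩
    rw [mem_preimage] at hy
    rwa [← hA.length_eq hy, hω]
  · exact fun h => ⟨_, mem_preimage.2 h, by simp⟩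

theorem length_preimage_le (hA : IsTable A) (x : List Bool) :
    (A.preimage x).length ≤ (boolStrings (2 * x.length)).length := by
  have hnodup : (A.preimage x).Nodup := hA.nodup_keys.sublist (List.filter_sublist.map _)
  exact (hnodup.subperm fun y hy => mem_boolStrings.2 (hA.length_eq (mem_preimage.1 hy))).length_le

theorem isAssignable_res (hA : IsTable A) (hω : ω ∈ A.live V x)
    (hsucc : ∀ b, ω ∉ A.live V (b :: x)) (b : Bool) :
    A.IsAssignable V (b :: x) (res ω (2 * x.length + 2)) := by
  have hx : (res ω (2 * x.length), x) ∈ A := hA.mem_openOf_preimage.1 hω.1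
  refine ⟨hx, fun hkey => ?_, fun hsub => hω.2 (hsub (mem_openOf_singleton.2 (by simp)))⟩
  obtain ⟨⟨-, x'⟩, hx', rfl⟩ := List.mem_map.1 hkey
  have hlen := hA.length_eq hx'
  rw [PiNat.res_length] at hlen
  obtain ⟨d, x', rfl⟩ : ∃ d z, x' = d :: z := List.exists_cons_of_length_pos (by omega)
  obtain rfl : x = x' := hA.eq_of_mem hx (hA.parent hx')
  exact hsucc d ⟨hA.mem_openOf_preimage.2 hx', hω.2⟩

theorem exists_isAssignable (hA : IsTable A)
    (h : uniformBernoulli.real (A.live V (false :: x)) +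
      uniformBernoulli.real (A.live V (true :: x)) < uniformBernoulli.real (A.live V x))
    (b : Bool) :
    ∃ y : List Bool, y.length = 2 * (b :: x).length ∧ A.IsAssignable V (b :: x) y := by
  have hnot : ¬ A.live V x ⊆ A.live V (false :: x) ∪ A.live V (true :: x) := fun hsub =>
    ((measureReal_mono hsub).trans (measureReal_union_le _ _)).not_gt h
  obtain ⟨ω, hω, hsucc⟩ := Set.not_subset.1 hnot
  rw [Set.mem_union, not_or] at hsucc
  exact ⟨_, by simp [mul_add], hA.isAssignable_res hω (Bool.forall_bool.2 hsucc) b⟩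

theorem live_nil (hA : IsTable A) (V : List (List Bool)) : A.live V [] = (openOf V)ᶜ := by
  ext ω
  rw [live, Set.mem_sdiff, hA.mem_openOf_preimage]
  exact and_iff_right hA.root

end IsTable

theorem eventuallyConst_of_prefix {α : Type*} {f : ℕ → List α} (hf : ∀ s t, s ≤ t → f s <+: f t)
    {N : ℕ} (hN : ∀ s, (f s).length ≤ N) : EventuallyConst f atTop := by
  let len : ℕ →o Fin (N + 1) :=
    ⟨fun s => ⟨(f s).length, Nat.lt_succ_of_le (hN s)⟩, fun s t h => (hf s t h).length_le⟩
  obtain ⟨s, hs⟩ := WellFoundedGT.monotone_chain_condition len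
  exact eventuallyConst_atTop.2
    ⟨s, fun t ht => ((hf s t ht).eq_of_length (congrArg Fin.val (hs t ht))).symm⟩

section Alloc

variable {U : ℕ → List (List Bool)}

/-- The table constructed in `s` steps against the increasing lists `U` of rejected strings. Every
output string is considered at infinitely many stages. -/
noncomputable def alloc (U : ℕ → List (List Bool)) : ℕ → Table
  | 0 => [([], [])]
  | s + 1 => (alloc U s).extend (U s) (decodeString s.unpair.1)

theorem alloc_prefix (U : ℕ → List (List Bool)) {s t : ℕ} (h : s ≤ t) :
    alloc U s <+: alloc U t := by
  induction t, h using Nat.le_induction with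
  | base => exact List.prefix_rfl
  | succ t _ ih => exact ih.trans (prefix_extend _ _ _)

theorem isTable_alloc (U : ℕ → List (List Bool)) (s : ℕ) : IsTable (alloc U s) := by
  induction s with
  | zero => exact isTable_singleton
  | succ s ih => exact ih.extend _ _

theorem eventuallyConst_preimage_alloc (U : ℕ → List (List Bool)) (x : List Bool) :
    EventuallyConst (fun s => (alloc U s).preimage x) atTop :=
  eventuallyConst_of_prefix (fun _ _ h => preimage_prefix (alloc_prefix U h) x)
    fun s => (isTable_alloc U s).length_preimage_le x

theorem measureReal_live_alloc_le (hU : ∀ s t, s ≤ t → U s ⊆ U t) (s : ℕ) {x : List Bool}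
    (hx : x ≠ []) :
    uniformBernoulli.real ((alloc U s).live (U s) x) ≤
      2⁻¹ ^ (2 * x.length + 1) + 2⁻¹ ^ (2 * x.length) := by
  induction s with
  | zero =>
    have hempty : (alloc U 0).live (U 0) x = ∅ := by
      simp [live, alloc, preimage, openOf, hx.symm]
    rw [hempty, measureReal_empty]
    positivity
  | succ s ih =>
    calc uniformBernoulli.real ((alloc U (s + 1)).live (U (s + 1)) x)
        ≤ uniformBernoulli.real ((alloc U (s + 1)).live (U s) x) :=
          measureReal_mono (live_anti _ (hU _ _ s.le_succ) x)
      _ ≤ _ := (measureReal_live_extend_le _ _ _ _).trans (max_le ih le_rfl)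

-- In units of `2 ^ (-(2 * |x| + 3))`, the parent has at least 4, the poor child less than 1 and
-- the other child at most 3.
theorem length_preimage_alloc_lt (hU : ∀ s t, s ≤ t → U s ⊆ U t) {s : ℕ} {b : Bool}
    {x : List Bool} (hs : decodeString s.unpair.1 = b :: x)
    (hpoor : (alloc U s).IsPoor (U s) (b :: x)) (hparent : ¬ (alloc U s).IsPoor (U s) x) :
    ((alloc U s).preimage (b :: x)).length < ((alloc U (s + 1)).preimage (b :: x)).length := by
  have hsum : uniformBernoulli.real ((alloc U s).live (U s) (false :: x)) +
      uniformBernoulli.real ((alloc U s).live (U s) (true :: x)) <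
        uniformBernoulli.real ((alloc U s).live (U s) x) := by
    have hfalse := measureReal_live_alloc_le hU s (x := false :: x) (by simp)
    have htrue := measureReal_live_alloc_le hU s (x := true :: x) (by simp)
    have hunit : (2⁻¹ : ℝ) ^ (2 * x.length + 1) = 4 * 2⁻¹ ^ (2 * (x.length + 1) + 1) := by ring
    have hunit' : (2⁻¹ : ℝ) ^ (2 * (x.length + 1)) = 2 * 2⁻¹ ^ (2 * (x.length + 1) + 1) := by ring
    simp only [IsPoor, not_lt, List.length_cons] at hfalse htrue hpoor hparent
    cases b <;> linarith
  obtain ⟨y, hlen, hy⟩ := (isTable_alloc U s).exists_isAssignable hsum b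
  rw [alloc, hs]
  exact length_preimage_lt_extend hpoor hlen hy

theorem eventually_not_isPoor (hU : ∀ s t, s ≤ t → U s ⊆ U t)
    (hμ : ∀ s, uniformBernoulli.real (openOf (U s)) ≤ 2⁻¹) (x : List Bool) :
    ∀ᶠ s in atTop, ¬ (alloc U s).IsPoor (U s) x := by
  induction x with
  | nil =>
    refine Eventually.of_forall fun s => ?_
    rw [IsPoor, (isTable_alloc U s).live_nil,
      probReal_compl_eq_one_sub (isOpen_openOf _).measurableSet]
    norm_num
    linarith [hμ s]
  | cons b x ih =>
    obtain ⟨s₀, hparent⟩ := eventually_atTop.1 ih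
    obtain ⟨s₁, hconst⟩ := eventuallyConst_atTop.1 (eventuallyConst_preimage_alloc U (b :: x))
    refine eventually_atTop.2 ⟨max s₀ s₁, fun s hs hpoor => ?_⟩
    let t := Nat.pair (encode (b :: x)) s
    have hst : s ≤ t := Nat.right_le_pair _ _
    have hpoor' : (alloc U t).IsPoor (U t) (b :: x) := by
      refine (measureReal_mono ?_).trans_lt hpoor
      refine (live_anti _ (hU s t hst) _).trans ?_
      rw [live, hconst t (by omega), ← hconst s (by omega), live]
    have hlt := length_preimage_alloc_lt hU
      (by rw [Nat.unpair_pair, decodeString_encode]) hpoor' (hparent t (by omega))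
    rw [hconst t (by omega), hconst (t + 1) (by omega)] at hlt
    exact lt_irrefl _ hlt

theorem exists_forall_res_mem_alloc (hU : ∀ s t, s ≤ t → U s ⊆ U t)
    (hμ : ∀ s, uniformBernoulli.real (openOf (U s)) ≤ 2⁻¹) (α : BinSeq) :
    ∃ ω : BinSeq, (∀ s, ω ∉ openOf (U s)) ∧
      ∀ n, ∃ s, (res ω (2 * n), res α n) ∈ alloc U s := by
  let K (n : ℕ) : Set BinSeq := {ω | ∃ s, (res ω (2 * n), res α n) ∈ alloc U s} \ openOf (U n)
  have hclosed (n : ℕ) : IsClosed (K n) :=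
    (isOpen_compl_iff.1 (isLocallyConstant_res (2 * n)
      {y | ∃ s, (y, res α n) ∈ alloc U s}ᶜ)).sdiff (isOpen_openOf _)
  have hanti (n : ℕ) : K (n + 1) ⊆ K n := by
    rintro ω ⟨⟨s, hs⟩, hω⟩
    exact ⟨⟨s, (isTable_alloc U s).parent hs⟩,
      fun h => hω (openOf_mono (hU _ _ n.le_succ) h)⟩
  have hne (n : ℕ) : (K n).Nonempty := by
    obtain ⟨s, hs, hns⟩ :=
      ((eventually_not_isPoor hU hμ (res α n)).and (eventually_ge_atTop n)).exists
    have hpos : 0 < uniformBernoulli.real ((alloc U s).live (U s) (res α n)) :=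
      (by positivity : (0 : ℝ) < _).trans_le (not_lt.1 hs)
    obtain ⟨ω, hω, hUω⟩ := nonempty_of_measureReal_ne_zero hpos.ne'
    rw [(isTable_alloc U s).mem_openOf_preimage, PiNat.res_length] at hω
    exact ⟨ω, ⟨s, hω⟩, fun h => hUω (openOf_mono (hU n s hns) h)⟩
  obtain ⟨ω, hω⟩ := IsCompact.nonempty_iInter_of_sequence_nonempty_isCompact_isClosed K hanti hne
    (hclosed 0).isCompact hclosed
  rw [Set.mem_iInter] at hω
  exact ⟨ω, fun s => (hω s).2, fun n => (hω n).1⟩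

/-- The last output bit that the table of stage `s` assigns to the (backwards) input `y`. -/
noncomputable def lastBit (U : ℕ → List (List Bool)) (s : ℕ) (y : List Bool) : Option Bool :=
  ((alloc U s).lookup y).bind List.head?

theorem lastBit_mono {s t : ℕ} (h : s ≤ t) {y : List Bool} {b : Bool}
    (hb : lastBit U s y = some b) : lastBit U t y = some b := by
  obtain ⟨x, hx, hb⟩ := Option.bind_eq_some_iff.1 hb
  exact Option.bind_eq_some_iff.2 ⟨x, (alloc_prefix U h).lookup_eq_some hx, hb⟩

theorem lastBit_of_mem {s : ℕ} {y x : List Bool} {b : Bool} (h : (y, b :: x) ∈ alloc U s) :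
    lastBit U s y = some b := by
  simp [lastBit, (isTable_alloc U s).lookup_eq_some_iff.2 h]

end Alloc

section PrimrecAlloc

theorem primrec_preimage : Primrec₂ preimage := by
  have h : PrimrecRel fun (p : List Bool × List Bool) (x : List Bool) => p.2 = x :=
    Primrec.eq.comp (Primrec.snd.comp Primrec.fst) Primrec.snd
  exact Primrec.list_map h.listFilter (Primrec.fst.comp Primrec.snd)

theorem primrecPred_isPoor :
    PrimrecPred fun p : (Table × List (List Bool)) × List Bool => p.1.1.IsPoor p.1.2 p.2 := by
  have hexp : Primrec fun p : (Table × List (List Bool)) × List Bool => 2 * p.2.length + 1 :=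
    Primrec.succ.comp
      (Primrec.nat_mul.comp (Primrec.const 2) (Primrec.list_length.comp Primrec.snd))
  exact primrecPred_uniformBernoulli_sdiff_lt.comp (Primrec.pair (Primrec.pair
    (primrec_preimage.comp (Primrec.fst.comp Primrec.fst) Primrec.snd)
    (Primrec.snd.comp Primrec.fst)) hexp)

theorem primrecRel_isAssignable :
    PrimrecRel fun (y : List Bool) (p : (Table × List (List Bool)) × List Bool) =>
      p.1.1.IsAssignable p.1.2 p.2 y := by
  have hmem {α : Type} [Primcodable α] : PrimrecRel fun (a : α) (L : List α) => a ∈ L :=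
    (Primrec.eq.exists_mem_list.comp Primrec.snd Primrec.fst).of_eq fun p => by simp
  have hA : Primrec fun q : List Bool × (Table × List (List Bool)) × List Bool => q.2.1.1 :=
    Primrec.fst.comp (Primrec.fst.comp Primrec.snd)
  have hkeys : Primrec fun q : List Bool × (Table × List (List Bool)) × List Bool =>
      q.2.1.1.map Prod.fst :=
    Primrec.list_map hA (Primrec.fst.comp Primrec.snd)
  refine (hmem.comp (Primrec.pair (Primrec.list_drop.comp (Primrec.const 2) Primrec.fst)
    (Primrec.list_tail.comp (Primrec.snd.comp Primrec.snd))) hA).and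
    ((hmem.comp Primrec.fst hkeys).not.and (primrecRel_openOf_subset.comp
      (Primrec.list_cons.comp Primrec.fst (Primrec.const []))
      (Primrec.snd.comp (Primrec.fst.comp Primrec.snd))).not)

theorem primrec_extend :
    Primrec fun p : (Table × List (List Bool)) × List Bool => p.1.1.extend p.1.2 p.2 := by
  classical
  have hfirst : Primrec fun p : (Table × List (List Bool)) × List Bool =>
      p.1.1.firstAssignable p.1.2 p.2 :=
    Primrec.list_head?.comp (primrecRel_isAssignable.listFilter.comp (primrec_boolStrings.comp
      (Primrec.nat_mul.comp (Primrec.const 2) (Primrec.list_length.comp Primrec.snd))) Primrec.id)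
  exact Primrec.ite primrecPred_isPoor
    (Primrec.list_append.comp (Primrec.fst.comp Primrec.fst) (Primrec.optionToList.comp
      (Primrec.option_map hfirst (Primrec.pair Primrec.snd (Primrec.snd.comp Primrec.fst)))))
    (Primrec.fst.comp Primrec.fst)

theorem primrec_alloc {U : ℕ → List (List Bool)} (hU : Primrec U) : Primrec (alloc U) := by
  have hstring : Primrec fun p : ℕ × Table => decodeString p.1.unpair.1 :=
    primrec_decodeString.comp (Primrec.fst.comp (Primrec.unpair.comp Primrec.fst))
  have hargs : Primrec fun p : ℕ × Table => ((p.2, U p.1), decodeString p.1.unpair.1) :=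
    Primrec.pair (Primrec.pair Primrec.snd (hU.comp Primrec.fst)) hstring
  have hrec (s : ℕ) : Nat.rec ([([], [])] : Table)
      (fun s A => A.extend (U s) (decodeString s.unpair.1)) s = alloc U s := by
    induction s with
    | zero => rfl
    | succ s ih => rw [alloc, ← ih]
  exact (Primrec.nat_rec₁ _ (primrec_extend.comp hargs).to₂).of_eq hrec

theorem primrec_lastBit {U : ℕ → List (List Bool)} (hU : Primrec U) : Primrec₂ (lastBit U) := by
  have hlookup : Primrec₂ (List.lookup : List Bool → Table → Option (List Bool)) := by
    convert Primrec.listLookup (α := List Bool) (β := List Bool)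
  exact Primrec.option_bind (hlookup.comp Primrec.snd ((primrec_alloc hU).comp Primrec.fst))
    (Primrec.list_head?.comp Primrec.snd)

end PrimrecAlloc

end Table

/-! ### Oracle machines -/

section Oracle

variable {α β γ : Type*} [Primcodable α] [Primcodable β] [Primcodable γ] {O : Set (ℕ →. ℕ)}

theorem computableIn_comp {g : β → γ} {f : α → β} (hg : ComputableIn O g)
    (hf : ComputableIn O f) : ComputableIn O fun a => g (f a) :=
  (Nat.RecursiveIn.comp hg hf).of_eq fun n => by
    cases decode (α := α) n <;> simp

theorem computableIn_pair {f : α → β} {g : α → γ} (hf : ComputableIn O f)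
    (hg : ComputableIn O g) : ComputableIn O fun a => (f a, g a) :=
  (Nat.RecursiveIn.pair hf hg).of_eq fun n => by
    cases decode (α := α) n <;> simp [Seq.seq]

theorem computableIn_iterate {f : α → α} (hf : ComputableIn O f) (a : α) :
    ComputableIn O fun n : ℕ => f^[n] a := by
  have hstart : Nat.RecursiveIn O fun _ => Part.some (encode a) :=
    Nat.Primrec.recursiveIn (Nat.Primrec.const (encode a))
  have hstep : Nat.RecursiveIn O fun p =>
      (decode (α := α) p.unpair.2.unpair.2 : Part α).bind fun x => Part.some (encode (f x)) :=
    (Nat.RecursiveIn.comp hf (.comp .right .right)).of_eq fun p => by simp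
  have hzero : Nat.RecursiveIn O fun n => Part.some (Nat.pair 0 n) :=
    Nat.Primrec.recursiveIn (Primrec.nat_iff.1
      (Primrec₂.natPair.comp (Primrec.const 0) Primrec.id))
  refine (Nat.RecursiveIn.comp (.prec hstart hstep) hzero).of_eq fun n => ?_
  simp only [Part.bind_eq_bind, Part.bind_some, Nat.unpair_pair, decode_nat, Part.coe_some,
    Part.map_some]
  induction n with
  | zero => rfl
  | succ n ih => simp [ih, Function.iterate_succ_apply']

theorem exists_computableIn_search {p : ℕ × ℕ → Bool} (hp : ComputableIn O p)
    (hex : ∀ n, ∃ t, p (n, t) = true) :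
    ∃ τ : ℕ → ℕ, ComputableIn O τ ∧ ∀ n, p (n, τ n) = true := by
  refine ⟨fun n => Nat.find (hex n), ?_, fun n => Nat.find_spec (hex n)⟩
  have hnot : ComputableIn O fun q => (!p q).toNat :=
    computableIn_comp (g := fun b : Bool => (!b).toNat) (Primrec.dom_finite _).computableIn hp
  refine (Nat.RecursiveIn.rfind hnot).of_eq fun n => ?_
  simp only [decode_nat, Part.coe_some, Part.bind_some, Part.map_some, encode_nat]
  refine Part.eq_some_iff.2 (Nat.mem_rfind.2 ⟨?_, fun {m} hm => ?_⟩)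
  · simpa using Nat.find_spec (hex n)
  · simpa using Nat.find_min (hex n) hm

theorem computableIn_toPFun (ω : BinSeq) : ComputableIn {ω.toPFun} ω :=
  (Nat.RecursiveIn.oracle _ (Set.mem_singleton ω.toPFun)).of_eq fun n => by
    cases h : ω n <;> simp [BinSeq.toPFun, h]

theorem turingReducible_iff_computableIn {α ω : BinSeq} :
    TuringReducible α.toPFun ω.toPFun ↔ ComputableIn {ω.toPFun} α := by
  have h : α.toPFun = fun n => Part.some (encode (α n)) := by
    funext n
    cases h : α n <;> simp [BinSeq.toPFun, h]
  simp [TuringReducible, h, ComputableIn, RecursiveIn]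

end Oracle

namespace OracleMachine

section Output

variable (M : OracleMachine)

theorem run_output_prefix (ω : BinSeq) {s t : ℕ} (h : s ≤ t) :
    (M.run ω s).2 <+: (M.run ω t).2 := by
  induction t, h using Nat.le_induction with
  | base => exact List.prefix_rfl
  | succ t _ ih => exact ih.trans (List.prefix_append _ _)

variable {M}

theorem getElem?_run_mono {ω : BinSeq} {s t n : ℕ} {b : Bool} (h : s ≤ t)
    (hb : (M.run ω s).2[n]? = some b) : (M.run ω t).2[n]? = some b := by
  obtain ⟨l, hl⟩ := M.run_output_prefix ω h
  rw [← hl, List.getElem?_append_left (List.getElem?_eq_some_iff.1 hb).1, hb]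

variable (M)

open Classical in
/-- The `n`-th bit that `M` writes on input `ω`, if there is one. -/
noncomputable def outputBit (ω : BinSeq) (n : ℕ) : Option Bool :=
  (Nat.rfindOpt fun t => (M.run ω t).2[n]?).toOption

variable {M}

theorem outputBit_eq_some_iff {ω : BinSeq} {n : ℕ} {b : Bool} :
    M.outputBit ω n = some b ↔ ∃ t, (M.run ω t).2[n]? = some b := by
  classical
  rw [outputBit, ← Option.mem_def]
  exact Part.mem_toOption.trans (Nat.rfindOpt_mono fun h hb => getElem?_run_mono h hb)

variable (M)

/-- The mapping computed by an oracle machine. -/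
noncomputable def output (ω : BinSeq) : FinInfSeq :=
  ⟨M.outputBit ω, by
    intro n hn
    rw [Option.eq_none_iff_forall_ne_some] at hn ⊢
    intro b hb
    obtain ⟨t, ht⟩ := outputBit_eq_some_iff.1 hb
    have hlt : n < (M.run ω t).2.length :=
      n.lt_succ_self.trans (List.getElem?_eq_some_iff.1 ht).1
    exact hn _ (outputBit_eq_some_iff.2 ⟨t, List.getElem?_eq_getElem hlt⟩)⟩

theorem computes_output : M.Computes M.output :=
  fun _ _ _ => outputBit_eq_some_iff

end Output

variable {M : OracleMachine} {T : BinSeq → FinInfSeq} {u : ℕ → ℕ}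

theorem run_congr (hu : Monotone u) (hM : M.UseBoundedBy u) {ω ω' : BinSeq} {n t : ℕ}
    (h : ∀ i < u n, ω i = ω' i) (ht : ∀ s < t, (M.run ω s).2.length < n) :
    M.run ω t = M.run ω' t := by
  induction t with
  | zero => rfl
  | succ t ih =>
    have hread : (M.query (M.run ω t).1).map ω = (M.query (M.run ω t).1).map ω' :=
      Option.map_congr fun i hi => h i ((hM ω t i hi).trans_le (hu (ht t t.lt_succ_self)))
    rw [run, run, hread, ih fun s hs => ht s (hs.trans t.lt_succ_self)]

theorem Computes.outputDependsOnFirst (hT : M.Computes T) (hu : Monotone u)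
    (hM : M.UseBoundedBy u) : OutputDependsOnFirst T u := by
  have hle {n m : ℕ} {ω ω' : BinSeq} (h : ∀ i < u n, ω i = ω' i) (hm : m < n) {b : Bool}
      (hb : (T ω).get? m = some b) : (T ω').get? m = some b := by
    obtain ⟨t, ht⟩ := (hT ω m b).1 hb
    have hex : ∃ t, (M.run ω t).2[m]? = some b := ⟨t, ht⟩
    rw [hT]
    have hshort (s : ℕ) (hs : s < Nat.find hex) : (M.run ω s).2.length < n := by
      refine lt_of_le_of_lt (not_lt.1 fun hlt => Nat.find_min hex hs ?_) hm
      have hc := List.getElem?_eq_getElem hlt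
      rw [hc, ← getElem?_run_mono hs.le hc, Nat.find_spec hex]
    exact ⟨Nat.find hex, run_congr hu hM h hshort ▸ Nat.find_spec hex⟩
  intro n ω ω' h m hm
  exact Option.ext fun b => ⟨hle h hm, hle (fun i hi => (h i hi).symm) hm⟩

variable (M) in
theorem computableIn_run (ω : BinSeq) : ComputableIn {ω.toPFun} (M.run ω) := by
  -- In the steps in which `M` reads nothing, the oracle is asked about position `0`.
  let step (c : (ℕ × List Bool) × Bool) : ℕ × List Bool :=
    (M.next c.1.1 ((M.query c.1.1).map fun _ => c.2), c.1.2 ++ (M.write c.1.1).toList)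
  have hstep : Computable step := by
    have hq : Computable fun c : (ℕ × List Bool) × Bool => c.1.1 :=
      Computable.fst.comp Computable.fst
    exact (M.computable_next.comp hq (Computable.option_map (M.computable_query.comp hq)
      (Computable.snd.comp Computable.fst).to₂)).pair (Computable.list_append.comp
        (Computable.snd.comp Computable.fst)
        (Primrec.optionToList.to_comp.comp (M.computable_write.comp hq)))
  have hbit : ComputableIn {ω.toPFun} fun c : ℕ × List Bool => ω ((M.query c.1).getD 0) :=
    computableIn_comp (computableIn_toPFun ω)
      (Computable.option_getD (M.computable_query.comp Computable.fst)
        (Computable.const 0)).computableIn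
  have hiter := computableIn_iterate (computableIn_comp hstep.computableIn
    (computableIn_pair (.id) hbit)) (0, [])
  convert hiter using 2 with t
  induction t with
  | zero => rfl
  | succ t ih =>
    rw [Function.iterate_succ_apply', ← ih, run]
    cases h : M.query (M.run ω t).1 <;> simp [step, h]

theorem Computes.turingReducible (hT : M.Computes T) {α ω : BinSeq} (h : T ω = α.toFinInf) :
    TuringReducible α.toPFun ω.toPFun := by
  have hrun : ComputableIn {ω.toPFun} fun p : ℕ × ℕ => (M.run ω p.2).2[p.1]? :=
    computableIn_comp (Primrec.list_getElem?.comp Primrec.snd Primrec.fst).computableIn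
      (computableIn_pair .fst
        (computableIn_comp .snd (computableIn_comp (computableIn_run M ω) .snd)))
  have hα (n : ℕ) (b : Bool) : α n = b ↔ ∃ t, (M.run ω t).2[n]? = some b := by
    rw [← hT, h]
    exact Option.some_inj.symm
  obtain ⟨τ, hτ, hdef⟩ := exists_computableIn_search
    (computableIn_comp Primrec.option_isSome.computableIn hrun) fun n => by
      obtain ⟨t, ht⟩ := (hα n _).1 rfl
      exact ⟨t, by rw [ht]; rfl⟩
  refine turingReducible_iff_computableIn.2 ?_
  convert computableIn_comp (Primrec.option_getD.comp Primrec.id (Primrec.const false)).computableIn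
    (computableIn_comp hrun (computableIn_pair .id hτ)) using 2 with n
  obtain ⟨b, hb⟩ := Option.isSome_iff_exists.1 (hdef n)
  simp [hb, (hα n b).2 ⟨_, hb⟩]

end OracleMachine

section Decoder

/-- A configuration `(y, n, s)` of a decoder machine: `y` is the part of the input read so far, last
bit first, `n` the number of bits written so far, and `s` the number of steps made so far. -/
abbrev DecoderConfig : Type := List Bool × ℕ × ℕ

variable {u : ℕ → ℕ} {f : ℕ → List Bool → Option Bool}

namespace DecoderConfig

/-- The configuration with a given code. -/
def ofCode (c : ℕ) : DecoderConfig := (decode c).getD ([], 0, 0)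

@[simp] theorem ofCode_encode (q : DecoderConfig) : ofCode (encode q) = q := by
  simp [ofCode]

variable (u f)

/-- The next input position, until the first `u (n + 1)` input bits are known. -/
def query (q : DecoderConfig) : Option ℕ :=
  if q.1.length < u (q.2.1 + 1) then some q.1.length else none

/-- The bit that `f` extracts from the first `u (n + 1)` input bits with a search up to `s`. -/
def write (q : DecoderConfig) : Option Bool :=
  if q.1.length < u (q.2.1 + 1) then none else f q.2.2 q.1

/-- The configuration after one step in which the input bit `a` was read. -/
def next (q : DecoderConfig) (a : Option Bool) : DecoderConfig :=
  (a.toList ++ q.1, q.2.1 + (q.write u f).toList.length, q.2.2 + 1)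

variable {u f}

theorem primrec_ofCode : Primrec ofCode :=
  Primrec.option_getD.comp Primrec.decode (Primrec.const _)

theorem primrecPred_length_lt (hu : Primrec u) :
    PrimrecPred fun q : DecoderConfig => q.1.length < u (q.2.1 + 1) :=
  Primrec.nat_lt.comp (Primrec.list_length.comp Primrec.fst)
    (hu.comp (Primrec.succ.comp (Primrec.fst.comp Primrec.snd)))

theorem primrec_query (hu : Primrec u) : Primrec (query u) :=
  Primrec.ite (primrecPred_length_lt hu)
    (Primrec.option_some.comp (Primrec.list_length.comp Primrec.fst)) (Primrec.const none)

theorem primrec_write (hu : Primrec u) (hf : Primrec₂ f) : Primrec (write u f) :=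
  Primrec.ite (primrecPred_length_lt hu) (Primrec.const none)
    (hf.comp (Primrec.snd.comp Primrec.snd) Primrec.fst)

theorem primrec_next (hu : Primrec u) (hf : Primrec₂ f) : Primrec₂ (next u f) := by
  have hread : Primrec fun p : DecoderConfig × Option Bool => p.2.toList ++ p.1.1 :=
    Primrec.list_append.comp (Primrec.optionToList.comp Primrec.snd)
      (Primrec.fst.comp Primrec.fst)
  have hwritten : Primrec fun p : DecoderConfig × Option Bool =>
      p.1.2.1 + (p.1.write u f).toList.length :=
    Primrec.nat_add.comp (Primrec.fst.comp (Primrec.snd.comp Primrec.fst))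
      (Primrec.list_length.comp
        (Primrec.optionToList.comp ((primrec_write hu hf).comp Primrec.fst)))
  have htime : Primrec fun p : DecoderConfig × Option Bool => p.1.2.2 + 1 :=
    Primrec.succ.comp (Primrec.snd.comp (Primrec.snd.comp Primrec.fst))
  exact Primrec.pair hread (Primrec.pair hwritten htime)

end DecoderConfig

/-- The machine that, having written `n` bits, reads the input up to its first `u (n + 1)` bits `y`,
waits for an `s` with `f s y ≠ none` and then writes this bit. -/
def decoderMachine (hu : Primrec u) (hf : Primrec₂ f) : OracleMachine where
  query c := (DecoderConfig.ofCode c).query u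
  write c := (DecoderConfig.ofCode c).write u f
  next c a := encode ((DecoderConfig.ofCode c).next u f a)
  computable_query := ((DecoderConfig.primrec_query hu).comp DecoderConfig.primrec_ofCode).to_comp
  computable_write :=
    ((DecoderConfig.primrec_write hu hf).comp DecoderConfig.primrec_ofCode).to_comp
  computable_next := (Primrec.encode.comp ((DecoderConfig.primrec_next hu hf).comp
    (DecoderConfig.primrec_ofCode.comp Primrec.fst) Primrec.snd)).to_comp

namespace decoderMachine

variable {hu : Primrec u} {hf : Primrec₂ f} {ω α : BinSeq} {t k n : ℕ} {o : List Bool}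

theorem run_succ {q : DecoderConfig} (h : (decoderMachine hu hf).run ω t = (encode q, o)) :
    (decoderMachine hu hf).run ω (t + 1) =
      (encode (q.next u f ((q.query u).map ω)), o ++ (q.write u f).toList) := by
  rw [OracleMachine.run, h]
  simp [decoderMachine]

theorem run_succ_of_lt (hk : k < u (n + 1))
    (h : (decoderMachine hu hf).run ω t = (encode (res ω k, n, t), o)) :
    (decoderMachine hu hf).run ω (t + 1) = (encode (res ω (k + 1), n, t + 1), o) := by
  rw [run_succ h]
  simp [DecoderConfig.next, DecoderConfig.query, DecoderConfig.write, hk, PiNat.res_succ]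

theorem run_succ_of_le (hk : u (n + 1) ≤ k)
    (h : (decoderMachine hu hf).run ω t = (encode (res ω k, n, t), o)) :
    (decoderMachine hu hf).run ω (t + 1) =
      (encode (res ω k, n + (f t (res ω k)).toList.length, t + 1),
        o ++ (f t (res ω k)).toList) := by
  rw [run_succ h]
  simp [DecoderConfig.next, DecoderConfig.query, DecoderConfig.write, hk.not_gt]

theorem exists_run_eq (hu : Primrec u) (hf : Primrec₂ f) (ω : BinSeq) (t : ℕ) : ∃ k o,
    (decoderMachine hu hf).run ω t = (encode (res ω k, o.length, t), o) := by
  induction t with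
  | zero => exact ⟨0, [], rfl⟩
  | succ t ih =>
    obtain ⟨k, o, h⟩ := ih
    rcases lt_or_ge k (u (o.length + 1)) with hk | hk
    · exact ⟨k + 1, o, run_succ_of_lt hk h⟩
    · exact ⟨k, _, by rw [run_succ_of_le hk h, List.length_append]⟩

theorem useBoundedBy (hu : Primrec u) (hf : Primrec₂ f) :
    (decoderMachine hu hf).UseBoundedBy u := by
  intro ω t i hi
  obtain ⟨k, o, h⟩ := exists_run_eq hu hf ω t
  rw [h] at hi ⊢
  change (DecoderConfig.ofCode (encode _)).query u = some i at hi
  rw [DecoderConfig.ofCode_encode, DecoderConfig.query, Option.ite_none_right_eq_some] at hi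
  exact Option.some.inj hi.2 ▸ hi.1

theorem exists_run_eq_of_le (hk : k ≤ u (n + 1))
    (h : (decoderMachine hu hf).run ω t = (encode (res ω k, n, t), o)) :
    ∃ t, (decoderMachine hu hf).run ω t = (encode (res ω (u (n + 1)), n, t), o) := by
  induction hk using Nat.decreasingInduction generalizing t with
  | self => exact ⟨t, h⟩
  | of_succ k hk ih => exact ih (run_succ_of_lt hk h)

theorem exists_run_eq_append {b : Bool} {s : ℕ}
    (hmono : ∀ (s t : ℕ) (y : List Bool) (b : Bool), s ≤ t → f s y = some b → f t y = some b)
    (hs : f s (res ω (u (n + 1))) = some b)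
    (h : (decoderMachine hu hf).run ω t = (encode (res ω (u (n + 1)), n, t), o)) :
    ∃ t, (decoderMachine hu hf).run ω t = (encode (res ω (u (n + 1)), n + 1, t), o ++ [b]) := by
  induction hm : s - t generalizing t with
  | zero =>
    have hb := hmono _ _ _ _ (Nat.sub_eq_zero_iff_le.1 hm) hs
    exact ⟨t + 1, by simpa [hb] using run_succ_of_le le_rfl h⟩
  | succ m ih =>
    have hstep := run_succ_of_le le_rfl h
    cases hb : f t (res ω (u (n + 1))) with
    | none =>
      rw [hb] at hstep
      exact ih (t := t + 1) (by simpa using hstep) (by omega)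
    | some c =>
      obtain rfl : c = b := Option.some.inj ((hmono t s _ c (by omega) hb).symm.trans hs)
      exact ⟨t + 1, by simpa [hb] using hstep⟩

theorem output_eq (hu : Primrec u) (hf : Primrec₂ f) (hmono : Monotone u)
    (hfmono : ∀ (s t : ℕ) (y : List Bool) (b : Bool), s ≤ t → f s y = some b → f t y = some b)
    (h : ∀ n, ∃ s, f s (res ω (u (n + 1))) = some (α n)) :
    (decoderMachine hu hf).output ω = α.toFinInf := by
  have hrun (n : ℕ) : ∃ t, ∃ k ≤ u n,
      (decoderMachine hu hf).run ω t = (encode (res ω k, n, t), (res α n).reverse) := by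
    induction n with
    | zero => exact ⟨0, 0, Nat.zero_le _, rfl⟩
    | succ n ih =>
      obtain ⟨_, k, hk, ih⟩ := ih
      obtain ⟨t, hread⟩ := exists_run_eq_of_le (hk.trans (hmono n.le_succ)) ih
      obtain ⟨s, hs⟩ := h n
      obtain ⟨t', hwritten⟩ := exists_run_eq_append (f := f) hfmono hs hread
      exact ⟨t', _, le_rfl, by rw [hwritten, PiNat.res_succ, List.reverse_cons]⟩
  refine Stream'.Seq.ext fun n => ?_
  have hα : α.toFinInf.get? n = some (α n) := rfl
  obtain ⟨t, k, -, ht⟩ := hrun (n + 1)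
  rw [hα, OracleMachine.computes_output]
  exact ⟨t, by simp [ht, reverse_res]⟩

end decoderMachine

end Decoder

theorem exists_oracleMachine_forall_exists_output_eq {U : ℕ → List (List Bool)} (hU : Primrec U)
    (hmono : ∀ s t, s ≤ t → U s ⊆ U t) (hμ : ∀ s, uniformBernoulli.real (openOf (U s)) ≤ 2⁻¹) :
    ∃ M : OracleMachine, (M.UseBoundedBy fun n => 2 * n) ∧
      ∀ α : BinSeq, ∃ ω : BinSeq, (∀ s, ω ∉ openOf (U s)) ∧ M.output ω = α.toFinInf := by
  have hdouble : Primrec fun n => 2 * n := Primrec.nat_mul.comp (Primrec.const 2) Primrec.id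
  have hbit := primrec_lastBit hU
  refine ⟨decoderMachine hdouble hbit, decoderMachine.useBoundedBy hdouble hbit, fun α => ?_⟩
  obtain ⟨ω, hω, halloc⟩ := exists_forall_res_mem_alloc hmono hμ α
  refine ⟨ω, hω, decoderMachine.output_eq hdouble hbit (fun m n h => Nat.mul_le_mul_left 2 h)
    (fun _ _ _ _ h => lastBit_mono h) fun n => ?_⟩
  obtain ⟨s, hs⟩ := halloc (n + 1)
  exact ⟨s, lastBit_of_mem hs⟩

theorem mainTheorem4 :
    ∃ (T : BinSeq → FinInfSeq) (c : ℕ),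
      (∃ M : OracleMachine, M.Computes T ∧ M.UseBoundedBy fun n => 2 * n + c) ∧
      OutputDependsOnFirst T (fun n => 2 * n + c) ∧
      ∀ α : BinSeq, ∃ ω : BinSeq,
        IsMartinLofRandom ω ∧ T ω = α.toFinInf ∧ TuringReducible α.toPFun ω.toPFun := by
  obtain ⟨M, huse, hM⟩ := exists_oracleMachine_forall_exists_output_eq primrec_universalStrings
    (fun _ _ => universalStrings_mono) uniformBernoulli_openOf_universalStrings_le
  have hcomp := M.computes_output
  refine ⟨M.output, 0, ⟨M, hcomp, huse⟩,
    hcomp.outputDependsOnFirst (fun m n h => Nat.mul_le_mul_left 2 h) huse, fun α => ?_⟩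
  obtain ⟨ω, hω, hα⟩ := hM α
  exact ⟨ω, isMartinLofRandom_of_forall_notMem hω, hα, hcomp.turingReducible hα⟩
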